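/- **Theorem 2.** For positive integers $q,d$ let $\mathbb{T}_d$ be the infinite $(d+1)$-regular tree, and for a finite graph $G=(V,E)$ let $\mu_G$ be the uniform distribution on the proper $q$-colorings $\sigma:V\to[q]$ of $G$. An assignment $\eta:\Lambda\to[q]$ with $\Lambda\subseteq V$ is *extendible* if it is the restriction to $\Lambda$ of a proper $q$-coloring of $G$. For $\zeta:\mathbb{Z}_{\ge 0}\to[0,1]$, the $q$-coloring model has *strong spatial mixing on the finite graph $G$ with decay rate $\zeta$* if for every $v\in V$, every $\Lambda\subseteq V$, every two extendible assignments $\eta,\eta':\Lambda\to[q]$ and every color $c\in[q]$, $$\big|\mu_G(\sigma_v=c\mid\sigma_\Lambda=\eta)-\mu_G(\sigma_v=c\mid\sigma_\Lambda=\eta')\big|\le\zeta\big(\mathrm{dist}_G(v,\Delta)\big),$$ where $\Delta\subseteq\Lambda$ is the set of vertices where $\eta$ and $\eta'$ disagree (if no vertex of $\Delta$ is reachable from $v$, the left side is $0$ and nothing is required). It has *strong spatial mixing on an infinite graph with decay rate $\zeta$* if it has it, with the same $\zeta$, on every finite subgraph. There is an absolute constant $\beta>0$ such that for all positive integers $q,d$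 with $q\ge 1.59\,d+\beta$ there exist constants $\alpha,C>0$ and a function $\zeta:\mathbb{Z}_{\ge 0}\to[0,1]$ with $\zeta(\ell)\le C\exp(-\alpha\ell)$ for all integers $\ell\ge 0$ such that the $q$-coloring model has strong spatial mixing on $\mathbb{T}_d$ with decay rate $\zeta$; in particular, it has strong spatial mixing with the same decay rate $\zeta$ on every finite subtree of $\mathbb{T}_d$. Moreover, the constant $1.59$ can be replaced by any real $\alpha'>1$ satisfying $$\frac{1}{\alpha'}\exp\Big(\frac{1}{\alpha'}\Big)\exp\Big(-\frac{1}{\alpha'-1+\exp\big(\frac{1}{\alpha'-1}\big)}\Big)<1,$$ that is, for each such $\alpha'$ there is a constant $\beta=\beta(\alpha')>0$ such that the conclusion above holds for all positive integers $q,d$ with $q\ge\alpha' d+\beta$. -/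

import Mathlib

open MeasureTheory ProbabilityTheory

universe u

noncomputable section

namespace TreeColoring

/-- The set `Ω_G` of proper `q`-colorings of `G`, as assignments `V → [q]`. -/
def properColorings {V : Type u} (G : SimpleGraph V) (q : ℕ) : Set (V → Fin q) :=
  {σ | ∀ u v : V, G.Adj u v → σ u ≠ σ v}

/-- `μ_G`: the uniform probability distribution on the proper `q`-colorings of `G`. -/
def colorMeasure {V : Type u} (G : SimpleGraph V) (q : ℕ) : Measure (V → Fin q) :=
  uniformOn (properColorings G q)

/-- The event `σ_Λ = η`. -/
def agreeOn {V : Type u} {q : ℕ} (Λ : Set V) (η : Λ → Fin q) : Set (V → Fin q) :=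
  {σ | ∀ u : Λ, σ u = η u}

/-- `η : Λ → [q]` is extendible: it is the restriction to `Λ` of a proper coloring of `G`. -/
def Extendible {V : Type u} (G : SimpleGraph V) {q : ℕ} (Λ : Set V) (η : Λ → Fin q) : Prop :=
  ∃ σ ∈ properColorings G q, ∀ u : Λ, σ u = η u

/-- The marginal `μ_G(σ_v = c ∣ σ_Λ = η)`. -/
def marginal {V : Type u} (G : SimpleGraph V) {q : ℕ} (Λ : Set V) (η : Λ → Fin q)
    (v : V) (c : Fin q) : ℝ :=
  (cond (colorMeasure G q) (agreeOn Λ η)).real {σ | σ v = c}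

/-- The set `Δ ⊆ Λ` of vertices where `η` and `η'` disagree. -/
def disagreement {V : Type u} {q : ℕ} (Λ : Set V) (η η' : Λ → Fin q) : Set V :=
  {u | ∃ h : u ∈ Λ, η ⟨u, h⟩ ≠ η' ⟨u, h⟩}

/-- The graph distance from `v` to the set `S`; it is `⊤` if no vertex of `S` can be reached
from `v`, in particular if `S` is empty. -/
def distToSet {V : Type u} (G : SimpleGraph V) (v : V) (S : Set V) : ℕ∞ :=
  ⨅ u ∈ S, G.edist v u

/-- Strong spatial mixing of the `q`-coloring model on a finite graph `G` with decay rate `ζ`.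
If the distance from `v` to the disagreement set is infinite (no disagreement in the component
of `v`), the two marginals at `v` coincide and there is nothing to require. -/
def SSMFinite {V : Type u} (G : SimpleGraph V) (q : ℕ) (ζ : ℕ → Set.Icc (0 : ℝ) 1) : Prop :=
  ∀ (v : V) (Λ : Set V) (η η' : Λ → Fin q), Extendible G Λ η → Extendible G Λ η' →
    ∀ (c : Fin q) (l : ℕ), distToSet G v (disagreement Λ η η') = (l : ℕ∞) →
      |marginal G Λ η v c - marginal G Λ η' v c| ≤ (ζ l : ℝ)

/-- Strong spatial mixing of the `q`-coloring model on an infinite graph `G` with decay rate `ζ`: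
strong spatial mixing with decay rate `ζ` on every finite subgraph of `G`. -/
def SSM {V : Type u} (G : SimpleGraph V) (q : ℕ) (ζ : ℕ → Set.Icc (0 : ℝ) 1) : Prop :=
  ∀ H : G.Subgraph, H.verts.Finite → SSMFinite H.coe q ζ

/-- `G` is the infinite `(d+1)`-regular tree: a tree all of whose vertices have `d + 1`
neighbors. For `d ≥ 1` it is automatically infinite and unique up to isomorphism. -/
structure IsRegularTree {V : Type u} (G : SimpleGraph V) (d : ℕ) : Prop where
  isTree : G.IsTree
  regular : ∀ v : V, (G.neighborSet v).ncard = d + 1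

end TreeColoring

end

/-!
For every `a > 1` there is a `β` such that `q ≥ a d + β` implies strong spatial mixing on the
`(d + 1)`-regular tree (`exists_ssm_of_one_lt`); the theorem follows with `a = 1.59` and `a = α'`.

Let `v` be a free vertex of a finite forest. Once the edges at `v` are removed, its neighbors `i` lie
in distinct components, so their colors are independent, and the marginal at `v` satisfies
`p(c) ∝ ∏ᵢ (1 - pᵢ(c))` (`marginal_eq_prod_div_sum`). A pinned neighbor removes at most one color; let
`L` be the set of the remaining colors and `k` the number of free neighbors. In the coordinates
`y = √p`, `xᵢ = √pᵢ` the vector `y` is a normalized vector, normalizing only shrinks velocities, and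
the Cauchy-Schwarz inequality bounds the squared norm of the Jacobian of `(xᵢ) ↦ y` by
`max_c p(c) ∑ᵢ pᵢ(c) / (1 - pᵢ(c))²`.

All marginals at free vertices are at most `1 / (q - d - 1)`, which is small when `β` is large
(`marginal_mul_le_one`); up to a factor `B` close to `1`, the quantity above is therefore
`S e^{-S} / Z` with `S = ∑ᵢ pᵢ(c)`, where `S e^{-S} ≤ 1 / e` and, by convexity, the normalizing
constant `Z` is at least `|L| e^{-B k / |L|}`. Since `B k / |L| ≤ ρ < 1`, the squared distance
contracts by `k · (B / (e |L|)) e^ρ ≤ ρ e^{ρ - 1} < 1` at every step (`sum_sqrtStep_sub_sq_le`), and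
induction on the distance to the disagreement set gives exponential decay
(`sum_sqrt_marginal_sub_sq_le`). Pinned neighbors in the disagreement set occur only at the last
step, where the trivial bound `2` is used. The extra edge at a root of degree `d + 1` is absorbed
by `β`, so all vertices are treated as having at most `D = d + 1` neighbors.
-/

noncomputable section

namespace TreeColoring

/-! ### Contraction of the tree recursion -/

lemma mul_exp_neg_le (s : ℝ) : s * Real.exp (-s) ≤ Real.exp (-1) := by
  have h := Real.add_one_le_exp (s - 1)
  have h2 : Real.exp (-1) = Real.exp (s - 1) * Real.exp (-s) := by
    rw [← Real.exp_add]; congr 1; ring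
  rw [h2]
  exact mul_le_mul_of_nonneg_right (by linarith) (Real.exp_pos _).le

lemma exp_neg_mul_le_one_sub {B δ s : ℝ} (hs : 0 ≤ s) (hsδ : s ≤ δ) (hδ : δ < 1)
    (hB : 1 ≤ B * (1 - δ) ^ 2) : Real.exp (-(B * s)) ≤ 1 - s := by
  have h1 : 0 < 1 - s := by linarith
  have hB0 : 0 < B := by
    by_contra h
    nlinarith [sq_nonneg (1 - δ)]
  have h2 : 1 ≤ B * (1 - s) := by
    have : (1 - δ) ^ 2 ≤ 1 - s := by nlinarith
    nlinarith
  rw [Real.exp_neg]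
  apply inv_le_of_inv_le₀ h1
  have h3 := Real.add_one_le_exp (B * s)
  refine le_trans ?_ h3
  rw [inv_le_iff_one_le_mul₀ h1]
  nlinarith

/-- The weight `∏ᵢ (1 - xᵢ(c)²)` of the color `c` at a vertex whose neighbors `i ∈ s` have, away
from that vertex, marginals `xᵢ²`. -/
def weight {ι κ : Type*} (s : Finset ι) (x : ι → κ → ℝ) (c : κ) : ℝ :=
  ∏ i ∈ s, (1 - x i c ^ 2)

section Contraction

variable {ι κ : Type*} {s : Finset ι} {L : Finset κ} {x : ι → κ → ℝ} {B δ ρ : ℝ}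

lemma weight_pos (hδ : δ < 1) (hxδ : ∀ i ∈ s, ∀ c, x i c ^ 2 ≤ δ) (c : κ) :
    0 < weight s x c :=
  Finset.prod_pos fun i hi => by linarith [hxδ i hi c]

lemma weight_le_exp (hδ : δ < 1) (hxδ : ∀ i ∈ s, ∀ c, x i c ^ 2 ≤ δ) (c : κ) :
    weight s x c ≤ Real.exp (-∑ i ∈ s, x i c ^ 2) := by
  rw [← Finset.sum_neg_distrib, Real.exp_sum]
  refine Finset.prod_le_prod (fun i hi => by linarith [hxδ i hi c]) fun i hi => ?_
  linarith [Real.add_one_le_exp (-x i c ^ 2)]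

lemma exp_le_weight (hδ : δ < 1) (hB : 1 ≤ B * (1 - δ) ^ 2)
    (hxδ : ∀ i ∈ s, ∀ c, x i c ^ 2 ≤ δ) (c : κ) :
    Real.exp (-(B * ∑ i ∈ s, x i c ^ 2)) ≤ weight s x c := by
  rw [Finset.mul_sum, ← Finset.sum_neg_distrib, Real.exp_sum]
  exact Finset.prod_le_prod (fun i _ => (Real.exp_pos _).le) fun i hi =>
    exp_neg_mul_le_one_sub (sq_nonneg _) (hxδ i hi c) hδ hB

/-- The normalizing constant of the tree recursion is at least `|L| e^{-ρ}`: the average over the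
available colors of the exponents is at most `ρ`, and `exp` is convex. -/
lemma card_mul_exp_le_sum_weight (hδ : δ < 1) (hB : 1 ≤ B * (1 - δ) ^ 2)
    (hxδ : ∀ i ∈ s, ∀ c, x i c ^ 2 ≤ δ) (hx1 : ∀ i ∈ s, ∑ c ∈ L, x i c ^ 2 ≤ 1)
    (hρ : B * s.card ≤ ρ * L.card) (hB0 : 0 ≤ B) :
    L.card * Real.exp (-ρ) ≤ ∑ c ∈ L, weight s x c := by
  have h1 : ∑ c ∈ L, B * ∑ i ∈ s, x i c ^ 2 ≤ ρ * L.card := by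
    rw [← Finset.mul_sum, Finset.sum_comm]
    refine le_trans (mul_le_mul_of_nonneg_left (Finset.sum_le_sum hx1) hB0) ?_
    simpa using hρ
  -- the tangent of `t ↦ exp (-t)` at `ρ` bounds each summand from below
  have h2 : ∀ c ∈ L, Real.exp (-ρ) * (1 + ρ - B * ∑ i ∈ s, x i c ^ 2) ≤ weight s x c := by
    intro c _
    refine le_trans ?_ (exp_le_weight hδ hB hxδ c)
    have h3 := Real.add_one_le_exp (ρ - B * ∑ i ∈ s, x i c ^ 2)
    have h4 : Real.exp (-(B * ∑ i ∈ s, x i c ^ 2))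
        = Real.exp (-ρ) * Real.exp (ρ - B * ∑ i ∈ s, x i c ^ 2) := by
      rw [← Real.exp_add]; congr 1; ring
    rw [h4]
    exact mul_le_mul_of_nonneg_left (by linarith) (Real.exp_pos _).le
  refine le_trans ?_ (Finset.sum_le_sum h2)
  rw [← Finset.mul_sum, mul_comm]
  refine mul_le_mul_of_nonneg_left ?_ (Real.exp_pos _).le
  rw [Finset.sum_sub_distrib, Finset.sum_const, nsmul_eq_mul]
  linarith

/-- The Jacobian of the recursion in square-root coordinates, before projecting orthogonally to
the normalization constraint, has squared norm at most `ρ e^{ρ - 1} / |s|`. -/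
lemma sum_weight_mul_sq_le (hδ : δ < 1) (hB : 1 ≤ B * (1 - δ) ^ 2) (hL : L.Nonempty)
    (hxδ : ∀ i ∈ s, ∀ c, x i c ^ 2 ≤ δ) (hx1 : ∀ i ∈ s, ∑ c ∈ L, x i c ^ 2 ≤ 1)
    (hρ : B * s.card ≤ ρ * L.card) (hB0 : 0 ≤ B)
    {e : ι → κ → ℝ} {E : ℝ} (he : ∀ i ∈ s, ∑ c ∈ L, e i c ^ 2 ≤ E) (hE : 0 ≤ E) :
    ∑ c ∈ L, weight s x c * (∑ i ∈ s, x i c * e i c / (1 - x i c ^ 2)) ^ 2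
      ≤ ρ * Real.exp (ρ - 1) * E * ∑ c ∈ L, weight s x c := by
  have hterm : ∀ c ∈ L, weight s x c * (∑ i ∈ s, x i c * e i c / (1 - x i c ^ 2)) ^ 2
      ≤ B * Real.exp (-1) * ∑ i ∈ s, e i c ^ 2 := by
    intro c _
    have hcs : (∑ i ∈ s, x i c * e i c / (1 - x i c ^ 2)) ^ 2
        ≤ (∑ i ∈ s, (x i c / (1 - x i c ^ 2)) ^ 2) * ∑ i ∈ s, e i c ^ 2 := by
      have := Finset.sum_mul_sq_le_sq_mul_sq s (fun i => x i c / (1 - x i c ^ 2)) (fun i => e i c)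
      refine le_trans (le_of_eq ?_) this
      congr 1
      exact Finset.sum_congr rfl fun i _ => by ring
    have hS : ∑ i ∈ s, (x i c / (1 - x i c ^ 2)) ^ 2 ≤ B * ∑ i ∈ s, x i c ^ 2 := by
      rw [Finset.mul_sum]
      refine Finset.sum_le_sum fun i hi => ?_
      have h0 : 0 < 1 - x i c ^ 2 := by linarith [hxδ i hi c]
      have h1 : 1 ≤ B * (1 - x i c ^ 2) ^ 2 := by
        refine hB.trans (mul_le_mul_of_nonneg_left ?_ hB0)
        exact pow_le_pow_left₀ (by linarith) (by linarith [hxδ i hi c]) 2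
      rw [div_pow, div_le_iff₀ (by positivity)]
      nlinarith [sq_nonneg (x i c)]
    have hw := weight_le_exp hδ hxδ c
    have hw0 := (weight_pos hδ hxδ c).le
    have hS0 : 0 ≤ ∑ i ∈ s, x i c ^ 2 := Finset.sum_nonneg fun _ _ => sq_nonneg _
    have hE0 : 0 ≤ ∑ i ∈ s, e i c ^ 2 := Finset.sum_nonneg fun _ _ => sq_nonneg _
    calc weight s x c * (∑ i ∈ s, x i c * e i c / (1 - x i c ^ 2)) ^ 2
        ≤ weight s x c * ((B * ∑ i ∈ s, x i c ^ 2) * ∑ i ∈ s, e i c ^ 2) :=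
          mul_le_mul_of_nonneg_left
            (hcs.trans (mul_le_mul_of_nonneg_right hS hE0)) hw0
      _ ≤ Real.exp (-∑ i ∈ s, x i c ^ 2) * ((B * ∑ i ∈ s, x i c ^ 2) * ∑ i ∈ s, e i c ^ 2) :=
          mul_le_mul_of_nonneg_right hw (by positivity)
      _ = B * ((∑ i ∈ s, x i c ^ 2) * Real.exp (-∑ i ∈ s, x i c ^ 2)) * ∑ i ∈ s, e i c ^ 2 := by
          ring
      _ ≤ B * Real.exp (-1) * ∑ i ∈ s, e i c ^ 2 := by
          gcongr
          exact mul_exp_neg_le _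
  have hZ := card_mul_exp_le_sum_weight hδ hB hxδ hx1 hρ hB0
  have hLc : (0 : ℝ) < L.card := by exact_mod_cast hL.card_pos
  have hρ0 : 0 ≤ ρ := by
    by_contra h
    have : 0 ≤ B * (s.card : ℝ) := by positivity
    nlinarith
  calc _ ≤ ∑ c ∈ L, B * Real.exp (-1) * ∑ i ∈ s, e i c ^ 2 := Finset.sum_le_sum hterm
    _ = B * Real.exp (-1) * ∑ i ∈ s, ∑ c ∈ L, e i c ^ 2 := by
        rw [← Finset.mul_sum, Finset.sum_comm]
    _ ≤ B * Real.exp (-1) * (s.card * E) := by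
        gcongr
        simpa using Finset.sum_le_sum he
    _ = (B * s.card) * (Real.exp (-1) * E) := by ring
    _ ≤ (ρ * L.card) * (Real.exp (-1) * E) := by gcongr
    _ = ρ * Real.exp (ρ - 1) * E * (L.card * Real.exp (-ρ)) := by
        have : Real.exp (-1) = Real.exp (ρ - 1) * Real.exp (-ρ) := by
          rw [← Real.exp_add]; congr 1; ring
        rw [this]; ring
    _ ≤ _ := by gcongr

/-- One step of the tree recursion: the square root of the marginal of the color `c ∈ L`. -/
def sqrtStep (s : Finset ι) (L : Finset κ) (x : ι → κ → ℝ) (c : κ) : ℝ :=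
  √(weight s x c / ∑ b ∈ L, weight s x b)

lemma hasDerivAt_weight {X : ℝ → ι → κ → ℝ} {e : ι → κ → ℝ} {t : ℝ} {c : κ}
    (hX : ∀ i ∈ s, HasDerivAt (fun t => X t i c) (e i c) t)
    (hne : ∀ i ∈ s, 1 - X t i c ^ 2 ≠ 0) :
    HasDerivAt (fun t => weight s (X t) c)
      (weight s (X t) c * (2 * -∑ i ∈ s, X t i c * e i c / (1 - X t i c ^ 2))) t := by
  classical
  have h : HasDerivAt (fun t => weight s (X t) c) _ t :=
    HasDerivAt.fun_finsetProd (u := s) (f := fun i t => 1 - X t i c ^ 2)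
      (f' := fun i => - (2 * X t i c * e i c))
      fun i hi => by
        have := ((hX i hi).pow 2).const_sub 1
        exact this.congr_deriv (by ring)
  convert h using 1
  rw [← Finset.sum_neg_distrib, Finset.mul_sum, Finset.mul_sum]
  refine Finset.sum_congr rfl fun i hi => ?_
  have := hne i hi
  rw [weight, ← Finset.mul_prod_erase s _ hi]
  simp only [smul_eq_mul]
  field_simp

/-- Along a curve of inputs, `sqrtStep` moves with velocity `y (a - ∑ y² a)`, where `y` is its
value and `a` the logarithmic derivative of the square root of the weight. -/
lemma hasDerivAt_sqrtStep {X : ℝ → ι → κ → ℝ} {e : ι → κ → ℝ} {t : ℝ} {c : κ}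
    (hX : ∀ c, ∀ i ∈ s, HasDerivAt (fun t => X t i c) (e i c) t)
    (hne : ∀ c, ∀ i ∈ s, 0 < 1 - X t i c ^ 2) (hL : L.Nonempty) :
    HasDerivAt (fun t => sqrtStep s L (X t) c)
      (sqrtStep s L (X t) c * (-∑ i ∈ s, X t i c * e i c / (1 - X t i c ^ 2)
        - ∑ b ∈ L, weight s (X t) b / (∑ b ∈ L, weight s (X t) b) *
          -∑ i ∈ s, X t i b * e i b / (1 - X t i b ^ 2))) t := by
  have hw : ∀ c, 0 < weight s (X t) c := fun c => Finset.prod_pos (hne c)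
  have hZ : 0 < ∑ b ∈ L, weight s (X t) b := Finset.sum_pos (fun b _ => hw b) hL
  have hdw := fun c => hasDerivAt_weight (hX c) fun i hi => (hne c i hi).ne'
  have hdZ : HasDerivAt (fun t => ∑ b ∈ L, weight s (X t) b) _ t :=
    HasDerivAt.fun_sum fun b _ => hdw b
  have h := ((hdw c).fun_div hdZ hZ.ne').sqrt (div_pos (hw c) hZ).ne'
  refine h.congr_deriv ?_
  have hy : 0 < √(weight s (X t) c / ∑ b ∈ L, weight s (X t) b) :=
    Real.sqrt_pos.2 (div_pos (hw c) hZ)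
  rw [sqrtStep]
  have hsq := Real.sq_sqrt (div_pos (hw c) hZ).le
  set y := √(weight s (X t) c / ∑ b ∈ L, weight s (X t) b)
  have hsum : ∑ b ∈ L, weight s (X t) b / (∑ b ∈ L, weight s (X t) b) *
          -∑ i ∈ s, X t i b * e i b / (1 - X t i b ^ 2)
      = (∑ b ∈ L, weight s (X t) b * (2 * -∑ i ∈ s, X t i b * e i b / (1 - X t i b ^ 2)))
        / (2 * ∑ b ∈ L, weight s (X t) b) := by
    rw [Finset.sum_div]
    refine Finset.sum_congr rfl fun b _ => ?_
    field_simp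
  rw [hsum]
  set Z := ∑ b ∈ L, weight s (X t) b
  set A := ∑ i ∈ s, X t i c * e i c / (1 - X t i c ^ 2)
  set W := ∑ b ∈ L, weight s (X t) b * (2 * -∑ i ∈ s, X t i b * e i b / (1 - X t i b ^ 2))
  have hwc : weight s (X t) c = y ^ 2 * Z := by rw [hsq]; field_simp
  rw [hwc]
  field_simp

/-- The variance of `a` under the weights `w` is at most its second moment. -/
lemma sum_mul_sub_mean_sq_le {w a : κ → ℝ} (hw : ∑ c ∈ L, w c = 1) :
    ∑ c ∈ L, w c * (a c - ∑ b ∈ L, w b * a b) ^ 2 ≤ ∑ c ∈ L, w c * a c ^ 2 := by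
  set m := ∑ b ∈ L, w b * a b with hm
  have h : ∑ c ∈ L, w c * (a c - m) ^ 2
      = ∑ c ∈ L, w c * a c ^ 2 - 2 * m * ∑ c ∈ L, w c * a c + m ^ 2 * ∑ c ∈ L, w c := by
    rw [Finset.mul_sum L _ (2 * m), Finset.mul_sum L _ (m ^ 2), ← Finset.sum_sub_distrib,
      ← Finset.sum_add_distrib]
    exact Finset.sum_congr rfl fun c _ => by ring
  rw [h, hw, ← hm]
  nlinarith [sq_nonneg m]

/-- The tree recursion in square-root coordinates contracts squared Euclidean distance by the
factor `ρ e^{ρ - 1}`. -/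
theorem sum_sqrtStep_sub_sq_le (hδ : δ < 1) (hB : 1 ≤ B * (1 - δ) ^ 2) (hL : L.Nonempty)
    (hρ : B * s.card ≤ ρ * L.card) (hB0 : 0 ≤ B) {x' : ι → κ → ℝ}
    (hxδ : ∀ i ∈ s, ∀ c, x i c ^ 2 ≤ δ) (hx1 : ∀ i ∈ s, ∑ c ∈ L, x i c ^ 2 ≤ 1)
    (hxδ' : ∀ i ∈ s, ∀ c, x' i c ^ 2 ≤ δ) (hx1' : ∀ i ∈ s, ∑ c ∈ L, x' i c ^ 2 ≤ 1)
    {E : ℝ} (he : ∀ i ∈ s, ∑ c ∈ L, (x' i c - x i c) ^ 2 ≤ E) (hE : 0 ≤ E) :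
    ∑ c ∈ L, (sqrtStep s L x' c - sqrtStep s L x c) ^ 2 ≤ ρ * Real.exp (ρ - 1) * E := by
  set X : ℝ → ι → κ → ℝ := fun t i c => x i c + t * (x' i c - x i c) with hXdef
  set e : ι → κ → ℝ := fun i c => x' i c - x i c with hedef
  have hX : ∀ t c, ∀ i ∈ s, HasDerivAt (fun t => X t i c) (e i c) t := fun t c i _ => by
    exact (((hasDerivAt_id t).mul_const (e i c)).const_add (x i c)).congr_deriv (one_mul _)
  have hconv : ∀ t ∈ Set.Icc (0 : ℝ) 1, ∀ i c,
      X t i c ^ 2 ≤ (1 - t) * x i c ^ 2 + t * x' i c ^ 2 := by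
    rintro t ⟨h0, h1⟩ i c
    have : (1 - t) * x i c ^ 2 + t * x' i c ^ 2 - X t i c ^ 2
        = t * (1 - t) * (x' i c - x i c) ^ 2 := by simp only [hXdef]; ring
    have h2 : 0 ≤ t * (1 - t) * (x' i c - x i c) ^ 2 :=
      mul_nonneg (mul_nonneg h0 (by linarith)) (sq_nonneg _)
    linarith
  have hXδ : ∀ t ∈ Set.Icc (0 : ℝ) 1, ∀ i ∈ s, ∀ c, X t i c ^ 2 ≤ δ := by
    intro t ht i hi c
    have := hconv t ht i c
    nlinarith [hxδ i hi c, hxδ' i hi c, ht.1, ht.2]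
  have hX1 : ∀ t ∈ Set.Icc (0 : ℝ) 1, ∀ i ∈ s, ∑ c ∈ L, X t i c ^ 2 ≤ 1 := by
    intro t ht i hi
    refine (Finset.sum_le_sum fun c _ => hconv t ht i c).trans ?_
    rw [Finset.sum_add_distrib, ← Finset.mul_sum, ← Finset.mul_sum]
    nlinarith [hx1 i hi, hx1' i hi, ht.1, ht.2]
  have hne : ∀ t ∈ Set.Icc (0 : ℝ) 1, ∀ c, ∀ i ∈ s, 0 < 1 - X t i c ^ 2 :=
    fun t ht c i hi => by linarith [hXδ t ht i hi c]
  set v : κ → ℝ := fun c => sqrtStep s L x' c - sqrtStep s L x c with hv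
  -- the mean value theorem, applied to the component of the curve along the total displacement
  have hd : ∀ t ∈ Set.Icc (0 : ℝ) 1,
      HasDerivAt (fun t => ∑ c ∈ L, v c * sqrtStep s L (X t) c) _ t := fun t ht =>
    HasDerivAt.fun_sum fun c _ =>
      (hasDerivAt_sqrtStep (c := c) (hX t) (hne t ht) hL).const_mul (v c)
  obtain ⟨t, ht, heq⟩ := exists_hasDerivAt_eq_slope _ _ (zero_lt_one' ℝ)
    (fun t ht => (hd t ht).continuousAt.continuousWithinAt)
    fun t ht => hd t (Set.Ioo_subset_Icc_self ht)
  have ht' := Set.Ioo_subset_Icc_self ht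
  have hX_one : X 1 = x' := by ext i c; simp [hXdef]
  have hX_zero : X 0 = x := by ext i c; simp [hXdef]
  rw [sub_zero, div_one, hX_one, hX_zero, ← Finset.sum_sub_distrib] at heq
  have hw : ∀ c, 0 < weight s (X t) c := weight_pos hδ (hXδ t ht')
  have hZ : 0 < ∑ b ∈ L, weight s (X t) b := Finset.sum_pos (fun b _ => hw b) hL
  have hV : ∑ c ∈ L, (v c * sqrtStep s L x' c - v c * sqrtStep s L x c) = ∑ c ∈ L, v c ^ 2 :=
    Finset.sum_congr rfl fun c _ => by simp only [hv]; ring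
  rw [hV] at heq
  set Z := ∑ b ∈ L, weight s (X t) b
  set a : κ → ℝ := fun c => -∑ i ∈ s, X t i c * e i c / (1 - X t i c ^ 2) with ha
  have hcs := Finset.sum_mul_sq_le_sq_mul_sq L v fun c =>
    sqrtStep s L (X t) c * (a c - ∑ b ∈ L, weight s (X t) b / Z * a b)
  rw [heq] at hcs
  have hvar : ∑ c ∈ L, (sqrtStep s L (X t) c * (a c - ∑ b ∈ L, weight s (X t) b / Z * a b)) ^ 2
      ≤ ρ * Real.exp (ρ - 1) * E := by
    calc _ = ∑ c ∈ L, weight s (X t) c / Z * (a c - ∑ b ∈ L, weight s (X t) b / Z * a b) ^ 2 := by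
          refine Finset.sum_congr rfl fun c _ => ?_
          rw [mul_pow, sqrtStep, Real.sq_sqrt (div_pos (hw c) hZ).le]
      _ ≤ ∑ c ∈ L, weight s (X t) c / Z * a c ^ 2 :=
          sum_mul_sub_mean_sq_le (by rw [← Finset.sum_div]; exact div_self hZ.ne')
      _ = (∑ c ∈ L, weight s (X t) c * (∑ i ∈ s, X t i c * e i c / (1 - X t i c ^ 2)) ^ 2) / Z := by
          rw [Finset.sum_div]
          refine Finset.sum_congr rfl fun c _ => ?_
          rw [ha, neg_sq]; ring
      _ ≤ _ := by
          rw [div_le_iff₀ hZ]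
          exact sum_weight_mul_sq_le hδ hB hL (hXδ t ht') (hX1 t ht') hρ hB0 he hE
  have hV0 : 0 ≤ ∑ c ∈ L, v c ^ 2 := Finset.sum_nonneg fun _ _ => sq_nonneg _
  rcases hV0.eq_or_lt with h0 | h0
  · rw [← h0]
    exact le_trans (Finset.sum_nonneg fun _ _ => sq_nonneg _) hvar
  · refine le_of_mul_le_mul_left ?_ h0
    rw [← sq]
    exact hcs.trans (mul_le_mul_of_nonneg_left hvar hV0)

end Contraction

/-! ### Counting colorings and the tree recursion -/

/-- The proper colorings of `G` that extend the assignment `η` on `Λ`. -/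
def pinnedColorings {V : Type u} (G : SimpleGraph V) {q : ℕ} (Λ : Set V) (η : Λ → Fin q) :
    Set (V → Fin q) :=
  properColorings G q ∩ agreeOn Λ η

section Counting

variable {W : Type u} {G G' : SimpleGraph W} {q : ℕ} {Λ : Set W} {η : Λ → Fin q}

lemma Extendible.anti (h : G' ≤ G) (hη : Extendible G Λ η) : Extendible G' Λ η := by
  obtain ⟨σ, hσ, hag⟩ := hη
  exact ⟨σ, fun u v huv => hσ u v (h huv), hag⟩

lemma marginal_nonneg (v : W) (c : Fin q) : 0 ≤ marginal G Λ η v c :=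
  measureReal_nonneg

/-- Spatial independence: if no edge of `G` joins `C` to its complement, an event `A` that only
depends on the colors in `C` is independent of an event `B` that only depends on the colors
outside `C`. Pairs of colorings are matched by exchanging their restrictions to `C`. -/
lemma ncard_mul_ncard_inter {C : Set W} (hC : ∀ u v, G.Adj u v → (u ∈ C ↔ v ∈ C))
    {A B : Set (W → Fin q)} (hA : ∀ σ τ : W → Fin q, Set.EqOn σ τ C → σ ∈ A → τ ∈ A)
    (hB : ∀ σ τ : W → Fin q, Set.EqOn σ τ Cᶜ → σ ∈ B → τ ∈ B) :
    (pinnedColorings G Λ η).ncard * (pinnedColorings G Λ η ∩ (A ∩ B)).ncard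
      = (pinnedColorings G Λ η ∩ A).ncard * (pinnedColorings G Λ η ∩ B).ncard := by
  classical
  set Ω := pinnedColorings G Λ η with hΩ
  have hmix : ∀ σ ∈ Ω, ∀ τ ∈ Ω, C.piecewise σ τ ∈ Ω := by
    rintro σ ⟨hσ, hσΛ⟩ τ ⟨hτ, hτΛ⟩
    refine ⟨fun u v huv => ?_, fun u => ?_⟩
    · by_cases hu : u ∈ C
      · rw [Set.piecewise_eq_of_mem _ _ _ hu, Set.piecewise_eq_of_mem _ _ _ ((hC u v huv).1 hu)]
        exact hσ u v huv
      · rw [Set.piecewise_eq_of_notMem _ _ _ hu,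
          Set.piecewise_eq_of_notMem _ _ _ (mt (hC u v huv).2 hu)]
        exact hτ u v huv
    · by_cases hu : (u : W) ∈ C
      · rw [Set.piecewise_eq_of_mem _ _ _ hu]; exact hσΛ u
      · rw [Set.piecewise_eq_of_notMem _ _ _ hu]; exact hτΛ u
  let F : (W → Fin q) × (W → Fin q) → (W → Fin q) × (W → Fin q) :=
    fun p => (C.piecewise p.1 p.2, C.piecewise p.2 p.1)
  have hF : Function.Involutive F := by
    rintro ⟨σ, τ⟩
    ext w <;> by_cases hw : w ∈ C <;> simp [F, hw]
  have hpA : ∀ σ ∈ A, ∀ τ, C.piecewise σ τ ∈ A := fun σ hσ τ =>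
    hA σ _ (Set.piecewise_eqOn C σ τ).symm hσ
  have hpB : ∀ τ ∈ B, ∀ σ, C.piecewise σ τ ∈ B := fun τ hτ σ =>
    hB τ _ (Set.piecewise_eqOn_compl C σ τ).symm hτ
  rw [mul_comm, ← Set.ncard_prod, ← Set.ncard_prod]
  refine Set.BijOn.ncard_eq (f := F) (Set.InvOn.bijOn (f' := F)
    ⟨fun p _ => hF p, fun p _ => hF p⟩ ?_ ?_)
  · rintro ⟨σ, τ⟩ ⟨⟨hσ, hσA, hσB⟩, hτ⟩
    exact ⟨⟨hmix σ hσ τ hτ, hpA σ hσA τ⟩, hmix τ hτ σ hσ, hpB σ hσB τ⟩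
  · rintro ⟨σ, τ⟩ ⟨⟨hσ, hσA⟩, hτ, hτB⟩
    exact ⟨⟨hmix σ hσ τ hτ, hpA σ hσA τ, hpB τ hτB σ⟩, hmix τ hτ σ hσ⟩

/-- The color of a free isolated vertex is uniform. -/
lemma ncard_inter_eq_of_isolated {v : W} (hv : v ∉ Λ) (hiso : ∀ u, ¬ G.Adj v u) (c c' : Fin q) :
    (pinnedColorings G Λ η ∩ {σ | σ v = c}).ncard
      = (pinnedColorings G Λ η ∩ {σ | σ v = c'}).ncard := by
  classical
  have hmap : ∀ c c' : Fin q, Set.MapsTo (fun σ => Function.update σ v c')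
      (pinnedColorings G Λ η ∩ {σ | σ v = c}) (pinnedColorings G Λ η ∩ {σ | σ v = c'}) := by
    rintro c c' σ ⟨⟨hσ, hσΛ⟩, _⟩
    refine ⟨⟨fun u w huw => ?_, fun u => ?_⟩, by simp⟩
    · have hu : u ≠ v := fun h => hiso w (h ▸ huw)
      have hw : w ≠ v := fun h => hiso u (h ▸ huw.symm)
      simpa [Function.update_of_ne hu, Function.update_of_ne hw] using hσ u w huw
    · have hu : (u : W) ≠ v := fun h => hv (h ▸ u.2)
      simpa [Function.update_of_ne hu] using hσΛ u
  refine Set.BijOn.ncard_eq (f := fun σ => Function.update σ v c')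
    (Set.InvOn.bijOn (f' := fun σ => Function.update σ v c) ⟨?_, ?_⟩ (hmap c c') (hmap c' c))
  · rintro σ ⟨_, rfl⟩; simp
  · rintro σ ⟨_, rfl⟩; simp

variable [Finite W]

lemma marginal_eq_ncard_div (v : W) (c : Fin q) :
    marginal G Λ η v c = ((pinnedColorings G Λ η ∩ {σ | σ v = c}).ncard : ℝ)
      / (pinnedColorings G Λ η).ncard := by
  have hfin : ∀ S : Set (W → Fin q), S.Finite := fun S => S.toFinite
  rw [marginal, colorMeasure, uniformOn, cond_cond_eq_cond_inter' (hfin _).measurableSet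
    (hfin _).measurableSet, Measure.real, cond_apply (hfin _).measurableSet, pinnedColorings,
    Measure.count_apply_finite _ (hfin _), Measure.count_apply_finite _ (hfin _),
    ← Set.ncard_eq_toFinset_card, ← Set.ncard_eq_toFinset_card]
  · simp [div_eq_inv_mul]
  · rw [Measure.count_apply_finite _ (hfin _)]
    exact ENNReal.natCast_ne_top _

lemma Extendible.ncard_pos (hη : Extendible G Λ η) : 0 < (pinnedColorings G Λ η).ncard := by
  obtain ⟨σ, hσ, hag⟩ := hη
  exact (Set.ncard_pos (Set.toFinite _)).2 ⟨σ, hσ, hag⟩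

lemma sum_ncard_inter_eq (S : Set (W → Fin q)) (v : W) :
    ∑ c : Fin q, (S ∩ {σ | σ v = c}).ncard = S.ncard := by
  classical
  have hS : S.Finite := S.toFinite
  rw [Set.ncard_eq_toFinset_card S hS,
    Finset.card_eq_sum_card_fiberwise (f := fun σ => σ v) (t := Finset.univ) fun _ _ => by simp]
  refine Finset.sum_congr rfl fun c _ => ?_
  rw [Set.ncard_eq_toFinset_card _ (hS.inter_of_left _)]
  congr 1
  ext σ
  simp

lemma sum_marginal (hη : Extendible G Λ η) (v : W) : ∑ c, marginal G Λ η v c = 1 := by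
  simp_rw [marginal_eq_ncard_div]
  rw [← Finset.sum_div, ← Nat.cast_sum, sum_ncard_inter_eq]
  exact div_self (by exact_mod_cast hη.ncard_pos.ne')

lemma marginal_le_one (hη : Extendible G Λ η) (v : W) (c : Fin q) : marginal G Λ η v c ≤ 1 := by
  rw [← sum_marginal hη v]
  exact Finset.single_le_sum (fun c _ => marginal_nonneg v c) (Finset.mem_univ c)

lemma marginal_of_mem (hη : Extendible G Λ η) {v : W} (hv : v ∈ Λ) (c : Fin q) :
    marginal G Λ η v c = if η ⟨v, hv⟩ = c then 1 else 0 := by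
  rw [marginal_eq_ncard_div]
  split_ifs with h
  · rw [Set.inter_eq_left.2]
    · exact div_self (by exact_mod_cast hη.ncard_pos.ne')
    · rintro σ ⟨_, hσ⟩
      exact (hσ ⟨v, hv⟩).trans h
  · rw [Set.eq_empty_of_forall_notMem (s := pinnedColorings G Λ η ∩ {σ | σ v = c})]
    · simp
    · rintro σ ⟨⟨_, hσ⟩, hc⟩
      exact h ((hσ ⟨v, hv⟩).symm.trans hc)

lemma ncard_inter_ne_eq (hη : Extendible G Λ η) (v : W) (c : Fin q) :
    ((pinnedColorings G Λ η ∩ {σ | σ v ≠ c}).ncard : ℝ)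
      = (pinnedColorings G Λ η).ncard * (1 - marginal G Λ η v c) := by
  have hpos : ((pinnedColorings G Λ η).ncard : ℝ) ≠ 0 := by exact_mod_cast hη.ncard_pos.ne'
  have h := Set.ncard_inter_add_ncard_sdiff_eq_ncard (pinnedColorings G Λ η) {σ | σ v = c}
    (Set.toFinite _)
  have h2 : pinnedColorings G Λ η \ {σ | σ v = c} = pinnedColorings G Λ η ∩ {σ | σ v ≠ c} := by
    ext σ; simp
  rw [h2] at h
  rw [marginal_eq_ncard_div, mul_sub, mul_one, mul_div_cancel₀ _ hpos, ← h]
  push_cast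
  ring

end Counting

section Recursion

variable {W : Type u} {G : SimpleGraph W} {q : ℕ} {Λ : Set W} {η : Λ → Fin q}

/-- In an acyclic graph, the neighbors of `v` lie in distinct components once the edges at `v` are
removed. -/
lemma eq_of_reachable_deleteIncidenceSet (hG : G.IsAcyclic) {v i j : W} (hi : G.Adj v i)
    (hj : G.Adj v j) (h : (G.deleteIncidenceSet v).Reachable i j) : i = j := by
  by_contra hij
  have hb := SimpleGraph.isAcyclic_iff_forall_adj_isBridge.1 hG hi
  rw [SimpleGraph.isBridge_iff] at hb
  apply hb
  have hle : G.deleteIncidenceSet v ≤ G.deleteEdges {s(v, i)} := by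
    intro a b hab
    rw [SimpleGraph.deleteIncidenceSet_adj] at hab
    rw [SimpleGraph.deleteEdges_adj]
    refine ⟨hab.1, ?_⟩
    simp only [Set.mem_singleton_iff, Sym2.eq_iff]
    rintro (⟨h1, _⟩ | ⟨_, h1⟩)
    · exact hab.2.1 h1
    · exact hab.2.2 h1
  have hvj : (G.deleteEdges {s(v, i)}).Adj v j := by
    rw [SimpleGraph.deleteEdges_adj]
    refine ⟨hj, ?_⟩
    simp only [Set.mem_singleton_iff, Sym2.eq_iff]
    rintro (⟨_, h1⟩ | ⟨h1, _⟩)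
    · exact hij h1.symm
    · exact hi.ne h1
  exact hvj.reachable.trans (h.mono hle).symm

variable [Finite W]

lemma ncard_inter_forall_ne (hG : G.IsAcyclic) {v : W} (c : Fin q)
    (hη : Extendible (G.deleteIncidenceSet v) Λ η) (s : Finset W) (hs : ∀ i ∈ s, G.Adj v i) :
    ((pinnedColorings (G.deleteIncidenceSet v) Λ η ∩
        ({σ | σ v = c} ∩ {σ | ∀ i ∈ s, σ i ≠ c})).ncard : ℝ)
      = (pinnedColorings (G.deleteIncidenceSet v) Λ η ∩ {σ | σ v = c}).ncard
        * ∏ i ∈ s, (1 - marginal (G.deleteIncidenceSet v) Λ η i c) := by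
  classical
  induction s using Finset.induction_on with
  | empty => simp
  | insert j s hj ih =>
    rw [Finset.prod_insert hj]
    have ih := ih fun i hi => hs i (Finset.mem_insert_of_mem hi)
    have hvj : G.Adj v j := hs j (Finset.mem_insert_self j s)
    have hpos : ((pinnedColorings (G.deleteIncidenceSet v) Λ η).ncard : ℝ) ≠ 0 := by
      exact_mod_cast hη.ncard_pos.ne'
    have hcomm : ({σ : W → Fin q | σ v = c} ∩ {σ | ∀ i ∈ insert j s, σ i ≠ c})
        = {σ | σ j ≠ c} ∩ ({σ | σ v = c} ∩ {σ | ∀ i ∈ s, σ i ≠ c}) := by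
      ext σ
      simp only [Set.mem_inter_iff, Set.mem_ofPred_eq, Finset.forall_mem_insert]
      tauto
    have hind := ncard_mul_ncard_inter (G := G.deleteIncidenceSet v) (Λ := Λ) (η := η)
      (C := {w | (G.deleteIncidenceSet v).Reachable j w})
      (A := {σ | σ j ≠ c}) (B := {σ | σ v = c} ∩ {σ | ∀ i ∈ s, σ i ≠ c})
      (fun a b hab => ⟨fun h => h.trans hab.reachable, fun h => h.trans hab.symm.reachable⟩)
      (fun σ τ h hσ => by
        have : σ j = τ j := h (SimpleGraph.Reachable.refl j)
        simpa [← this] using hσ)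
      (fun σ τ h hσ => by
        have hv : σ v = τ v := h fun hr => by
          obtain ⟨p⟩ := hr.symm
          cases p with
          | nil => exact hvj.ne rfl
          | cons hadj _ => exact (SimpleGraph.deleteIncidenceSet_adj.1 hadj).2.1 rfl
        refine ⟨hv.symm.trans hσ.1, fun i hi => ?_⟩
        have hi' : σ i = τ i := h fun hr => by
          have := eq_of_reachable_deleteIncidenceSet hG hvj
            (hs i (Finset.mem_insert_of_mem hi)) hr
          exact hj (this ▸ hi)
        exact hi' ▸ hσ.2 i hi)
    rw [hcomm]
    apply mul_left_cancel₀ hpos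
    rw [← Nat.cast_mul, hind, Nat.cast_mul, ih, ncard_inter_ne_eq hη]
    ring

/-- The tree recursion: the marginal of `c` at a free vertex `v` of an acyclic graph is
proportional to the probability that no neighbor has color `c` once the edges at `v` are removed;
the neighbors are then independent. -/
theorem marginal_eq_prod_div_sum [Fintype W] [DecidableRel G.Adj] (hG : G.IsAcyclic) {v : W}
    (hv : v ∉ Λ) (hη : Extendible G Λ η) (c : Fin q) :
    marginal G Λ η v c
      = (∏ i with G.Adj v i, (1 - marginal (G.deleteIncidenceSet v) Λ η i c))
        / ∑ b, ∏ i with G.Adj v i, (1 - marginal (G.deleteIncidenceSet v) Λ η i b) := by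
  have hη' := hη.anti (SimpleGraph.deleteIncidenceSet_le G v)
  have hset : ∀ c, pinnedColorings G Λ η ∩ {σ | σ v = c}
      = pinnedColorings (G.deleteIncidenceSet v) Λ η ∩
        ({σ | σ v = c} ∩ {σ | ∀ i ∈ ({i | G.Adj v i} : Finset W), σ i ≠ c}) := by
    intro c
    ext σ
    simp only [pinnedColorings, properColorings, Set.mem_inter_iff, Set.mem_ofPred_eq,
      Finset.mem_filter, Finset.mem_univ, true_and, SimpleGraph.deleteIncidenceSet_adj]
    constructor
    · rintro ⟨⟨h1, h2⟩, h3⟩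
      exact ⟨⟨fun a b hab => h1 a b hab.1, h2⟩, h3, fun i hi hc => h1 v i hi (h3.trans hc.symm)⟩
    · rintro ⟨⟨h1, h2⟩, h3, h4⟩
      refine ⟨⟨fun a b hab => ?_, h2⟩, h3⟩
      by_cases ha : a = v
      · subst ha; rw [h3]; exact (h4 b hab).symm
      by_cases hb : b = v
      · subst hb; rw [h3]; exact h4 a hab.symm
      exact h1 a b ⟨hab, ha, hb⟩
  have hN : ∀ c, ((pinnedColorings G Λ η ∩ {σ | σ v = c}).ncard : ℝ)
      = (pinnedColorings (G.deleteIncidenceSet v) Λ η ∩ {σ | σ v = c}).ncard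
        * ∏ i with G.Adj v i, (1 - marginal (G.deleteIncidenceSet v) Λ η i c) := fun c => by
    rw [hset, ncard_inter_forall_ne hG c hη' _ fun i hi => by simpa using hi]
  have hiso : ∀ b, (pinnedColorings (G.deleteIncidenceSet v) Λ η ∩ {σ | σ v = b}).ncard
      = (pinnedColorings (G.deleteIncidenceSet v) Λ η ∩ {σ | σ v = c}).ncard := fun b =>
    ncard_inter_eq_of_isolated hv (fun u hu => (SimpleGraph.deleteIncidenceSet_adj.1 hu).2.1 rfl)
      b c
  have hpos : 0 < (pinnedColorings (G.deleteIncidenceSet v) Λ η ∩ {σ | σ v = c}).ncard := by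
    have h := sum_ncard_inter_eq (pinnedColorings (G.deleteIncidenceSet v) Λ η) v
    simp_rw [hiso] at h
    refine Nat.pos_of_ne_zero fun h0 => hη'.ncard_pos.ne' ?_
    rw [← h, h0]; simp
  rw [marginal_eq_ncard_div, ← sum_ncard_inter_eq (pinnedColorings G Λ η) v, Nat.cast_sum]
  simp_rw [hN, hiso]
  rw [← Finset.mul_sum]
  exact mul_div_mul_left _ _ (by exact_mod_cast hpos.ne')

lemma one_sub_sum_le_prod {ι : Type*} (s : Finset ι) {f : ι → ℝ} (h0 : ∀ i ∈ s, 0 ≤ f i)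
    (h1 : ∀ i ∈ s, f i ≤ 1) : 1 - ∑ i ∈ s, f i ≤ ∏ i ∈ s, (1 - f i) := by
  classical
  induction s using Finset.induction_on with
  | empty => simp
  | insert j s hj ih =>
    rw [Finset.sum_insert hj, Finset.prod_insert hj]
    have ih := ih (fun i hi => h0 i (Finset.mem_insert_of_mem hi))
      fun i hi => h1 i (Finset.mem_insert_of_mem hi)
    have hj0 := h0 j (Finset.mem_insert_self j s)
    have hj1 := h1 j (Finset.mem_insert_self j s)
    have hs : 0 ≤ ∑ i ∈ s, f i :=
      Finset.sum_nonneg fun i hi => h0 i (Finset.mem_insert_of_mem hi)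
    nlinarith [mul_nonneg hj0 hs]

/-- A free vertex with at most `D` neighbors takes each color with probability at most
`1 / (q - D)`. -/
lemma marginal_mul_le_one [Fintype W] [DecidableRel G.Adj] (hG : G.IsAcyclic) {v : W} (hv : v ∉ Λ)
    (hη : Extendible G Λ η) {D : ℕ} (hD : ({i | G.Adj v i} : Finset W).card ≤ D) (hqD : D < q)
    (c : Fin q) : marginal G Λ η v c * (q - D) ≤ 1 := by
  have hη' := hη.anti (SimpleGraph.deleteIncidenceSet_le G v)
  have hqD' : (0 : ℝ) < q - D := by rw [sub_pos]; exact_mod_cast hqD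
  have hsum : (q - D : ℝ)
      ≤ ∑ b, ∏ i with G.Adj v i, (1 - marginal (G.deleteIncidenceSet v) Λ η i b) := by
    refine le_trans ?_ (Finset.sum_le_sum fun b _ => one_sub_sum_le_prod _
      (fun i _ => marginal_nonneg i b) fun i _ => marginal_le_one hη' i b)
    rw [Finset.sum_sub_distrib, Finset.sum_comm]
    simp_rw [sum_marginal hη']
    have : (({i | G.Adj v i} : Finset W).card : ℝ) ≤ D := by exact_mod_cast hD
    simp
    linarith
  have hprod : ∏ i with G.Adj v i, (1 - marginal (G.deleteIncidenceSet v) Λ η i c) ≤ 1 :=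
    Finset.prod_le_one (fun i _ => by linarith [marginal_le_one hη' i c])
      fun i _ => by linarith [marginal_nonneg (G := G.deleteIncidenceSet v) (η := η) i c]
  rw [marginal_eq_prod_div_sum hG hv hη, div_mul_eq_mul_div, div_le_one (by linarith)]
  refine le_trans ?_ hsum
  exact mul_le_of_le_one_left hqD'.le hprod

end Recursion

/-! ### Exponential decay of correlations -/

section Decay

variable {W : Type u} {G : SimpleGraph W} {q : ℕ} {Λ : Set W} {η : Λ → Fin q}

open Classical in
/-- The neighbors of `v` that are not pinned. -/
def freeNeighbors [Fintype W] (G : SimpleGraph W) (Λ : Set W) (v : W) : Finset W :=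
  {i | G.Adj v i ∧ i ∉ Λ}

open Classical in
/-- The colors that no pinned neighbor of `v` takes in `σ`. -/
def availableColors [Fintype W] (G : SimpleGraph W) (Λ : Set W) (σ : W → Fin q) (v : W) :
    Finset (Fin q) :=
  {c | ∀ i, G.Adj v i → i ∈ Λ → σ i ≠ c}

open Classical in
/-- Each pinned neighbor removes at most one color. -/
lemma le_card_availableColors [Fintype W] {v : W} {D : ℕ}
    (hD : ({i | G.Adj v i} : Finset W).card ≤ D) (σ : W → Fin q) :
    q + (freeNeighbors G Λ v).card ≤ (availableColors G Λ σ v).card + D := by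
  have h1 : (availableColors G Λ σ v)ᶜ
      ⊆ (({i | G.Adj v i ∧ i ∈ Λ} : Finset W).image σ) := by
    intro c hc
    simpa [availableColors, and_assoc] using hc
  have h2 := (Finset.card_le_card h1).trans Finset.card_image_le
  have h3 := Finset.card_add_card_compl (availableColors G Λ σ v)
  have h4 : ({i | G.Adj v i ∧ i ∈ Λ} : Finset W).card + (freeNeighbors G Λ v).card
      = ({i | G.Adj v i} : Finset W).card := by
    rw [freeNeighbors, ← Finset.filter_filter, ← Finset.filter_filter]
    exact Finset.card_filter_add_card_filter_not _
  rw [Fintype.card_fin] at h3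
  omega

open Classical in
lemma prod_one_sub_marginal [Fintype W] {v : W} {σ : W → Fin q} (hη : Extendible G Λ η)
    (hση : ∀ u : Λ, σ u = η u) {G' : SimpleGraph W} (c : Fin q) :
    ∏ i with G'.Adj v i, (1 - marginal G Λ η i c)
      = if c ∈ availableColors G' Λ σ v then
          weight (freeNeighbors G' Λ v) (fun i c => √(marginal G Λ η i c)) c else 0 := by
  split_ifs with hc
  · simp only [availableColors, Finset.mem_filter, Finset.mem_univ, true_and] at hc
    rw [weight, freeNeighbors, ← Finset.filter_filter]
    simp_rw [Real.sq_sqrt (marginal_nonneg _ _)]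
    refine (Finset.prod_filter_of_ne (p := fun i => i ∉ Λ) fun i hi hne hiΛ => hne ?_).symm
    rw [marginal_of_mem hη hiΛ, if_neg, sub_zero]
    rw [← hση]
    exact hc i (by simpa using hi) hiΛ
  · simp only [availableColors, Finset.mem_filter, Finset.mem_univ, true_and, not_forall,
      not_not] at hc
    obtain ⟨i, hi, hiΛ, hσ⟩ := hc
    refine Finset.prod_eq_zero (i := i) (by simpa using hi) ?_
    rw [marginal_of_mem hη hiΛ, ← hση, if_pos hσ, sub_self]

/-- The tree recursion in square-root coordinates. -/
lemma sqrt_marginal_eq [Fintype W] (hG : G.IsAcyclic) {v : W} (hv : v ∉ Λ) {σ : W → Fin q}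
    (hη : Extendible G Λ η) (hση : ∀ u : Λ, σ u = η u) (c : Fin q) :
    √(marginal G Λ η v c) = if c ∈ availableColors G Λ σ v then
      sqrtStep (freeNeighbors G Λ v) (availableColors G Λ σ v)
        (fun i c => √(marginal (G.deleteIncidenceSet v) Λ η i c)) c else 0 := by
  classical
  have hη' := hη.anti (SimpleGraph.deleteIncidenceSet_le G v)
  rw [marginal_eq_prod_div_sum hG hv hη]
  simp_rw [prod_one_sub_marginal (G' := G) (v := v) hη' hση]
  rw [← Finset.sum_filter, Finset.filter_mem_eq_inter, Finset.univ_inter]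
  split_ifs
  · rfl
  · simp

/-- Exponential decay of the squared Euclidean distance between the square roots of two marginals
at `v`, when the assignments only disagree at distance more than `n` from `v`. The graph varies in
the induction: the edges at `v` are removed, and the claim is applied at the neighbors of `v`. -/
theorem sum_sqrt_marginal_sub_sq_le [Fintype W] {η' : Λ → Fin q} {D : ℕ} {B δ ρ : ℝ}
    (hqD : D < q) (hδq : 1 ≤ δ * (q - D)) (hδ : δ < 1) (hB : 1 ≤ B * (1 - δ) ^ 2) (hB0 : 0 ≤ B)
    (hρ0 : 0 ≤ ρ) (hρB : ρ ≤ B) (hρ : B * D ≤ ρ * q) (n : ℕ) (v : W)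
    (hG : G.IsAcyclic) (hD : ∀ v, (G.neighborSet v).ncard ≤ D)
    (hη : Extendible G Λ η) (hη' : Extendible G Λ η')
    (hdist : ∀ u ∈ disagreement Λ η η', ((n + 1 : ℕ) : ℕ∞) ≤ G.edist v u) :
    ∑ c, (√(marginal G Λ η' v c) - √(marginal G Λ η v c)) ^ 2
      ≤ (ρ * Real.exp (ρ - 1)) ^ n * 2 := by
  classical
  induction n generalizing G v with
  | zero =>
    rw [pow_zero, one_mul]
    calc _ ≤ ∑ c, (marginal G Λ η' v c + marginal G Λ η v c) := by
          refine Finset.sum_le_sum fun c _ => ?_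
          have h1 := Real.sq_sqrt (marginal_nonneg (G := G) (η := η) v c)
          have h2 := Real.sq_sqrt (marginal_nonneg (G := G) (η := η') v c)
          nlinarith [mul_nonneg (Real.sqrt_nonneg (marginal G Λ η v c))
            (Real.sqrt_nonneg (marginal G Λ η' v c))]
      _ = 2 := by rw [Finset.sum_add_distrib, sum_marginal hη, sum_marginal hη']; norm_num
  | succ n ih =>
    have hagree : ∀ i (hi : i ∈ Λ), G.edist v i ≤ 1 → η ⟨i, hi⟩ = η' ⟨i, hi⟩ := by
      intro i hi hvi
      by_contra hne
      have h := (hdist i ⟨hi, hne⟩).trans hvi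
      have : n + 1 + 1 ≤ 1 := by exact_mod_cast h
      omega
    by_cases hv : v ∈ Λ
    · have h0 := hagree v hv (by simp)
      simp_rw [marginal_of_mem hη hv, marginal_of_mem hη' hv, h0]
      simp only [sub_self, ne_eq, OfNat.ofNat_ne_zero, not_false_eq_true, zero_pow,
        Finset.sum_const_zero]
      positivity
    obtain ⟨σ, -, hση⟩ := id hη
    obtain ⟨σ', -, hση'⟩ := id hη'
    have hav : availableColors G Λ σ' v = availableColors G Λ σ v := by
      ext c
      simp only [availableColors, Finset.mem_filter, Finset.mem_univ, true_and]
      refine forall_congr' fun i => forall_congr' fun hi => forall_congr' fun hiΛ => ?_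
      have := hagree i hiΛ (SimpleGraph.edist_eq_one_iff_adj.2 hi).le
      rw [hση' ⟨i, hiΛ⟩, hση ⟨i, hiΛ⟩, this]
    have hle := SimpleGraph.deleteIncidenceSet_le G v
    have hG' : (G.deleteIncidenceSet v).IsAcyclic := hG.anti hle
    have hD' : ∀ w, ((G.deleteIncidenceSet v).neighborSet w).ncard ≤ D := fun w =>
      (Set.ncard_le_ncard (fun u hu => hle hu) (Set.toFinite _)).trans (hD w)
    have hcard : ∀ {H : SimpleGraph W} (_ : ∀ w, (H.neighborSet w).ncard ≤ D) (w : W),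
        ({i | H.Adj w i} : Finset W).card ≤ D := by
      intro H hH w
      rw [← Set.ncard_coe_finset]
      refine le_trans (le_of_eq ?_) (hH w)
      congr 1
      ext i
      simp
    have hLcard := le_card_availableColors (Λ := Λ) (hcard hD v) σ
    have hL : (availableColors G Λ σ v).Nonempty := Finset.card_pos.1 (by omega)
    have hρs : B * (freeNeighbors G Λ v).card ≤ ρ * (availableColors G Λ σ v).card := by
      have h1 : (q : ℝ) + (freeNeighbors G Λ v).card ≤ (availableColors G Λ σ v).card + D := by
        exact_mod_cast hLcard
      have h2 : ((freeNeighbors G Λ v).card : ℝ) ≤ D := by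
        refine le_trans ?_ (Nat.cast_le.2 (hcard hD v))
        refine Nat.cast_le.2 (Finset.card_le_card fun i hi => ?_)
        simp only [freeNeighbors, Finset.mem_filter, Finset.mem_univ, true_and] at hi ⊢
        exact hi.1
      nlinarith [mul_le_mul_of_nonneg_left h1 hρ0,
        mul_nonneg (sub_nonneg.2 hρB) (sub_nonneg.2 h2)]
    have hbd : ∀ θ : Λ → Fin q, Extendible G Λ θ → ∀ i ∈ freeNeighbors G Λ v, ∀ c,
        √(marginal (G.deleteIncidenceSet v) Λ θ i c) ^ 2 ≤ δ := by
      intro θ hθ i hi c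
      simp only [freeNeighbors, Finset.mem_filter, Finset.mem_univ, true_and] at hi
      rw [Real.sq_sqrt (marginal_nonneg i c)]
      have hqD' : (0 : ℝ) < q - D := by rw [sub_pos]; exact_mod_cast hqD
      exact le_of_mul_le_mul_right
        ((marginal_mul_le_one hG' hi.2 (hθ.anti hle) (by convert hcard hD' i) hqD c).trans hδq) hqD'
    have hsum1 : ∀ θ : Λ → Fin q, Extendible G Λ θ → ∀ i ∈ freeNeighbors G Λ v,
        ∑ c ∈ availableColors G Λ σ v, √(marginal (G.deleteIncidenceSet v) Λ θ i c) ^ 2 ≤ 1 := by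
      intro θ hθ i _
      simp_rw [Real.sq_sqrt (marginal_nonneg i _)]
      rw [← sum_marginal (hθ.anti hle) i]
      exact Finset.sum_le_sum_of_subset_of_nonneg (Finset.subset_univ _)
        fun c _ _ => marginal_nonneg i c
    have hind : ∀ i ∈ freeNeighbors G Λ v, ∑ c ∈ availableColors G Λ σ v,
        (√(marginal (G.deleteIncidenceSet v) Λ η' i c)
          - √(marginal (G.deleteIncidenceSet v) Λ η i c)) ^ 2
        ≤ (ρ * Real.exp (ρ - 1)) ^ n * 2 := by
      intro i hi
      refine (Finset.sum_le_sum_of_subset_of_nonneg (Finset.subset_univ _)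
        fun c _ _ => sq_nonneg _).trans
        (ih i hG' hD' (hη.anti hle) (hη'.anti hle) fun u hu => ?_)
      simp only [freeNeighbors, Finset.mem_filter, Finset.mem_univ, true_and] at hi
      have h1 : ((n + 1 + 1 : ℕ) : ℕ∞) ≤ 1 + G.edist i u := by
        refine (hdist u hu).trans ((SimpleGraph.edist_triangle (v := i)).trans ?_)
        exact add_le_add (SimpleGraph.edist_eq_one_iff_adj.2 hi.1).le le_rfl
      have h2 : ((n + 1 : ℕ) : ℕ∞) ≤ G.edist i u := by
        rw [Nat.cast_add (n + 1) 1, add_comm, Nat.cast_one] at h1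
        exact (ENat.add_le_add_iff_left ENat.one_ne_top).1 h1
      exact h2.trans (SimpleGraph.edist_anti hle)
    have hstep := sum_sqrtStep_sub_sq_le hδ hB hL hρs hB0 (hbd η hη) (hsum1 η hη) (hbd η' hη')
      (hsum1 η' hη') hind (by positivity)
    simp_rw [sqrt_marginal_eq hG hv hη hση, sqrt_marginal_eq hG hv hη' hση', hav]
    rw [pow_succ', mul_assoc]
    refine le_trans (le_of_eq ?_) hstep
    rw [← Finset.sum_subset (Finset.subset_univ (availableColors G Λ σ v))]
    · exact Finset.sum_congr rfl fun c hc => by rw [if_pos hc, if_pos hc]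
    · intro c _ hc
      rw [if_neg hc, if_neg hc]; simp

lemma abs_marginal_sub_le_one [Finite W] {η' : Λ → Fin q} (hη : Extendible G Λ η)
    (hη' : Extendible G Λ η') (v : W) (c : Fin q) :
    |marginal G Λ η v c - marginal G Λ η' v c| ≤ 1 := by
  rw [abs_le]
  have h1 := marginal_nonneg (G := G) (η := η) v c
  have h2 := marginal_nonneg (G := G) (η := η') v c
  have h3 := marginal_le_one hη v c
  have h4 := marginal_le_one hη' v c
  constructor <;> linarith

lemma abs_marginal_sub_le [Fintype W] {η' : Λ → Fin q} (hη : Extendible G Λ η)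
    (hη' : Extendible G Λ η') (v : W) (c : Fin q) {E : ℝ}
    (h : ∑ c, (√(marginal G Λ η' v c) - √(marginal G Λ η v c)) ^ 2 ≤ E) :
    |marginal G Λ η v c - marginal G Λ η' v c| ≤ 2 * √E := by
  have h1 : (√(marginal G Λ η' v c) - √(marginal G Λ η v c)) ^ 2 ≤ E :=
    (Finset.single_le_sum (f := fun c => (√(marginal G Λ η' v c) - √(marginal G Λ η v c)) ^ 2)
      (fun c _ => sq_nonneg _) (Finset.mem_univ c)).trans h
  have h2 := Real.abs_le_sqrt h1
  have ha := marginal_nonneg (G := G) (η := η) v c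
  have hb := marginal_nonneg (G := G) (η := η') v c
  have ha1 := Real.sqrt_le_one.2 (marginal_le_one hη v c)
  have hb1 := Real.sqrt_le_one.2 (marginal_le_one hη' v c)
  have heq : marginal G Λ η v c - marginal G Λ η' v c
      = -((√(marginal G Λ η' v c) - √(marginal G Λ η v c))
        * (√(marginal G Λ η' v c) + √(marginal G Λ η v c))) := by
    have := Real.sq_sqrt ha
    have := Real.sq_sqrt hb
    nlinarith
  rw [heq, abs_neg, abs_mul, mul_comm,
    abs_of_nonneg (a := √(marginal G Λ η' v c) + √(marginal G Λ η v c)) (by positivity)]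
  exact mul_le_mul (by linarith) h2 (abs_nonneg _) zero_le_two

/-- Strong spatial mixing on finite forests of maximum degree at most `D`. -/
theorem ssmFinite_of_isAcyclic [Finite W] {D : ℕ} {B δ ρ : ℝ}
    (hqD : D < q) (hδq : 1 ≤ δ * (q - D)) (hδ : δ < 1) (hB : 1 ≤ B * (1 - δ) ^ 2) (hB0 : 0 ≤ B)
    (hρ0 : 0 ≤ ρ) (hρB : ρ ≤ B) (hρ : B * D ≤ ρ * q)
    (hG : G.IsAcyclic) (hD : ∀ v, (G.neighborSet v).ncard ≤ D) {ζ : ℕ → Set.Icc (0 : ℝ) 1}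
    (hζ0 : 1 ≤ (ζ 0 : ℝ))
    (hζ : ∀ n, min 1 (2 * √((ρ * Real.exp (ρ - 1)) ^ n * 2)) ≤ ζ (n + 1)) :
    SSMFinite G q ζ := by
  have := Fintype.ofFinite W
  intro v Λ η η' hη hη' c l hl
  rcases l with _ | n
  · exact (abs_marginal_sub_le_one hη hη' v c).trans hζ0
  · refine le_trans (le_min (abs_marginal_sub_le_one hη hη' v c)
      (abs_marginal_sub_le hη hη' v c ?_)) (hζ n)
    refine sum_sqrt_marginal_sub_sq_le hqD hδq hδ hB hB0 hρ0 hρB hρ n v hG hD hη hη' fun u hu => ?_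
    rw [← hl]
    exact iInf₂_le u hu

end Decay

/-- Strong spatial mixing of colorings on the `(d + 1)`-regular tree when `q ≥ a d + β`, for every
`a > 1`. -/
theorem exists_ssm_of_one_lt {a : ℝ} (ha : 1 < a) :
    ∃ β : ℝ, 0 < β ∧ ∀ q d : ℕ, 0 < q → 0 < d → a * (d : ℝ) + β ≤ (q : ℝ) →
      ∃ (α C : ℝ) (ζ : ℕ → Set.Icc (0 : ℝ) 1), 0 < α ∧ 0 < C ∧
        (∀ l : ℕ, (ζ l : ℝ) ≤ C * Real.exp (-α * (l : ℝ))) ∧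
        ∀ (V : Type u) (G : SimpleGraph V), IsRegularTree G d → SSM G q ζ := by
  obtain ⟨B, hB⟩ : ∃ B, B = (1 + a) / 2 := ⟨_, rfl⟩
  obtain ⟨ρ, hρ⟩ : ∃ ρ, ρ = B / a := ⟨_, rfl⟩
  -- `1 / δ` bounds `q - (d + 1)` from below; the constant `B > 1` absorbs the factor `(1 - δ)⁻²`
  obtain ⟨δ, hδ⟩ : ∃ δ, δ = (B - 1) / (2 * B) := ⟨_, rfl⟩
  have hB1 : 1 < B := by linarith
  have hρ0 : 0 < ρ := by rw [hρ]; positivity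
  have hρ1 : ρ < 1 := by rw [hρ, div_lt_one (by linarith)]; linarith
  have hδ0 : 0 < δ := by rw [hδ]; exact div_pos (by linarith) (by linarith)
  have hδB : δ * (2 * B) = B - 1 := by rw [hδ]; field_simp
  have hδ1 : δ < 1 := by nlinarith
  have hBδ : 1 ≤ B * (1 - δ) ^ 2 := by nlinarith [mul_nonneg (by linarith : 0 ≤ B) (sq_nonneg δ)]
  refine ⟨a + 1 / δ, by positivity, fun q d hq hd hqd => ?_⟩
  have hr0 : 0 < ρ * Real.exp (ρ - 1) := by positivity
  have hr1 : ρ * Real.exp (ρ - 1) < 1 := by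
    have : Real.exp (ρ - 1) < 1 := 
      (Real.exp_lt_exp.2 (by linarith)).trans_eq Real.exp_zero
    nlinarith [Real.exp_pos (ρ - 1)]
  obtain ⟨r, hr⟩ : ∃ r, r = √(ρ * Real.exp (ρ - 1)) := ⟨_, rfl⟩
  have hrpos : 0 < r := by rw [hr]; exact Real.sqrt_pos.2 hr0
  have hrlt : r < 1 := by rw [hr, Real.sqrt_lt' one_pos]; simpa using hr1
  have hexp : ∀ l : ℕ, Real.exp (-(-Real.log r) * l) = r ^ l := fun l => by
    rw [neg_neg, mul_comm, Real.exp_nat_mul, Real.exp_log hrpos]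
  have hC : 1 ≤ 2 * √2 / r := by
    rw [le_div_iff₀ hrpos]
    nlinarith [Real.one_lt_sqrt_two]
  refine ⟨-Real.log r, 2 * √2 / r,
    fun l => ⟨min 1 (2 * √2 / r * r ^ l), by positivity, min_le_left _ _⟩,
    neg_pos.2 (Real.log_neg hrpos hrlt), by positivity, fun l => ?_, fun V G hG H hH => ?_⟩
  · rw [hexp]
    exact min_le_right _ _
  · have : Finite H.verts := hH
    have hqd' : a * ((d + 1 : ℕ) : ℝ) + 1 / δ ≤ q := by push_cast; linarith
    have hdq : ((d + 1 : ℕ) : ℝ) + 1 / δ ≤ q := by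
      have : (0 : ℝ) ≤ ((d + 1 : ℕ) : ℝ) := Nat.cast_nonneg _
      nlinarith
    have hinv : 0 < 1 / δ := by positivity
    refine ssmFinite_of_isAcyclic (D := d + 1) (B := B) (δ := δ) (ρ := ρ) ?_ ?_ hδ1 hBδ
      (by linarith) hρ0.le (by linarith) ?_ (hG.isTree.isAcyclic.subgraph H) (fun v => ?_) ?_
      fun n => ?_
    · have : ((d + 1 : ℕ) : ℝ) < q := by linarith
      exact_mod_cast this
    · calc (1 : ℝ) = δ * (1 / δ) := by field_simp
        _ ≤ _ := by gcongr; linarith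
    · have h1 : B * ((d + 1 : ℕ) : ℝ) = ρ * (a * ((d + 1 : ℕ) : ℝ)) := by
        rw [hρ]; field_simp
      rw [h1]
      gcongr
      linarith
    · have hfin : (G.neighborSet (v : V)).Finite :=
        Set.finite_of_ncard_ne_zero (by rw [hG.regular]; omega)
      rw [← hG.regular (v : V)]
      exact Set.ncard_le_ncard_of_injOn Subtype.val (fun u hu => H.adj_sub hu)
        Subtype.val_injective.injOn hfin
    · simpa using hC
    · refine le_of_eq ?_
      show _ = min 1 (2 * √2 / r * r ^ (n + 1))
      have h1 : √((ρ * Real.exp (ρ - 1)) ^ n * 2) = r ^ n * √2 := by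
        rw [Real.sqrt_mul (by positivity), hr]
        congr 1
        rw [Real.sqrt_eq_iff_mul_self_eq (by positivity) (by positivity), ← mul_pow,
          Real.mul_self_sqrt hr0.le]
      rw [h1]
      congr 1
      field_simp
      ring

end TreeColoring

end

theorem theorem2 :
    (∃ β : ℝ, 0 < β ∧ ∀ q d : ℕ, 0 < q → 0 < d → (1.59 : ℝ) * (d : ℝ) + β ≤ (q : ℝ) →
      ∃ (α C : ℝ) (ζ : ℕ → Set.Icc (0 : ℝ) 1), 0 < α ∧ 0 < C ∧
        (∀ l : ℕ, (ζ l : ℝ) ≤ C * Real.exp (-α * (l : ℝ))) ∧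
        ∀ (V : Type u) (G : SimpleGraph V), TreeColoring.IsRegularTree G d →
          TreeColoring.SSM G q ζ) ∧
    (∀ α' : ℝ, 1 < α' →
      1 / α' * Real.exp (1 / α') *
        Real.exp (-(1 / (α' - 1 + Real.exp (1 / (α' - 1))))) < 1 →
      ∃ β : ℝ, 0 < β ∧ ∀ q d : ℕ, 0 < q → 0 < d → α' * (d : ℝ) + β ≤ (q : ℝ) →
        ∃ (α C : ℝ) (ζ : ℕ → Set.Icc (0 : ℝ) 1), 0 < α ∧ 0 < C ∧
          (∀ l : ℕ, (ζ l : ℝ) ≤ C * Real.exp (-α * (l : ℝ))) ∧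
          ∀ (V : Type u) (G : SimpleGraph V), TreeColoring.IsRegularTree G d →
            TreeColoring.SSM G q ζ) := by
  exact ⟨TreeColoring.exists_ssm_of_one_lt (by norm_num),
    fun _ hα' _ => TreeColoring.exists_ssm_of_one_lt hα'⟩
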